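/- Let $P$ be a finite poset and $k$ a field. Let $R=\mathcal R_k[\mathcal I(P)]\subseteq k[t,x_v : v\in P]$ be the Hibi ring of $P$, i.e. the $k$-subalgebra generated by the monomials $x_I=t\prod_{v\in I}x_v$, where $I$ runs over all poset ideals (down-closed subsets) of $P$; it is a normal Cohen–Macaulay domain, graded by the degree in $t$. Let $\omega$ be its canonical module, i.e. $\omega=\big(\bigwedge^{\dim R}\Omega_{R/k}\big)^{**}$, and $\omega^{(-1)}=\operatorname{Hom}_R(\omega,R)$, both with the induced grading. Call $R$ $\omega^{(-1)}$-level if $\omega^{(-1)}$ is generated over $R$ by homogeneous elements of one single degree; $R$ is Gorenstein if and only if $\omega$ is invertible. Let $\hat P=P\cup\{-\infty,\infty\}$ be $P$ with a least element $-\infty$ and a greatest element $\infty$ added. An upwards path of length $m$ in $\hat P$ is a tuple $(u_0,\dots,u_m)$ of elements of $\hat P$ in which $u_{i+1}$ covers $u_i$ for all $0\le i<m$. For $u\le w$ in $\hat P$ let $\operatorname{dist}(u,w)$ be the least length of an upwards path from $u$ to $w$, and put $$\operatorname{disp}(u,w)=\operatorname{dist}(u,w)+\operatorname{dist}(w,\infty)-\operatorname{dist}(u,\infty).$$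 Let $\hat P_{nonmin}$ be the set of elements of $\hat P$ that lie on no upwards path of minimal length from $-\infty$ to $\infty$. Suppose that $R$ is $\omega^{(-1)}$-level but not Gorenstein. Then there is an upwards path $(v_0,\dots,v_k)$ in $\hat P$, of some length $k\ge 1$, such that $(v_1,\dots,v_k)$ is an upwards path of maximal length among the upwards paths of $\hat P$ all of whose elements lie in $\hat P_{nonmin}$, and $$\sum_{i=1}^k\operatorname{disp}(v_{i-1},v_i)<k.$$ -/

import Mathlib

noncomputable section

namespace Hibi

/-! ### Upwards paths, distance and disparity -/

section Paths

variable {α : Type*} [PartialOrder α]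

/-- A nonempty tuple `(v₁, …, vₙ)` is an upwards path if each entry is covered by the next one.
Its length is `n - 1`. (Its entries are then automatically distinct.) -/
def IsUpwardsPath {n : ℕ} (v : Fin n → α) : Prop :=
  0 < n ∧ ∀ (i : ℕ) (h : i + 1 < n), v ⟨i, Nat.lt_of_succ_lt h⟩ ⋖ v ⟨i + 1, h⟩

/-- `v` is an upwards path of length `n` from `a` to `b`. -/
def IsUpwardsPathFromTo {n : ℕ} (v : Fin (n + 1) → α) (a b : α) : Prop :=
  IsUpwardsPath v ∧ v 0 = a ∧ v (Fin.last n) = b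

/-- The length of a shortest upwards path from `a` to `b` (only used for `a ≤ b` in a finite
poset, where such a path exists). -/
def dist (a b : α) : ℕ :=
  sInf {n : ℕ | ∃ v : Fin (n + 1) → α, IsUpwardsPathFromTo v a b}

/-- The disparity between `a` and `b` (only used for `a ≤ b`). -/
def disp [OrderTop α] (a b : α) : ℤ :=
  (dist a b : ℤ) + (dist b ⊤ : ℤ) - (dist a ⊤ : ℤ)

/-- `v` is a minimal length upwards path from `a` to `b`. -/
def IsMinimalLengthPath {n : ℕ} (v : Fin (n + 1) → α) (a b : α) : Prop :=
  IsUpwardsPathFromTo v a b ∧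
    ∀ (m : ℕ) (w : Fin (m + 1) → α), IsUpwardsPathFromTo w a b → n ≤ m

/-- The elements lying on some minimal length upwards path from `⊥` to `⊤`. -/
def minSubset (α : Type*) [PartialOrder α] [BoundedOrder α] : Set α :=
  {x | ∃ (n : ℕ) (v : Fin (n + 1) → α), IsMinimalLengthPath v ⊥ ⊤ ∧ x ∈ Set.range v}

/-- The elements lying on no minimal length upwards path from `⊥` to `⊤`. -/
def nonminSubset (α : Type*) [PartialOrder α] [BoundedOrder α] : Set α :=
  (minSubset α)ᶜ

/-- `v` is an upwards path (of the ambient poset) all of whose entries lie in `S`. -/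
def IsUpwardsPathIn (S : Set α) {n : ℕ} (v : Fin n → α) : Prop :=
  IsUpwardsPath v ∧ ∀ i, v i ∈ S

/-- `v` is an upwards path in `S`, and no upwards path in `S` is longer. -/
def IsMaximalLengthUpwardsPathIn (S : Set α) {n : ℕ} (v : Fin n → α) : Prop :=
  IsUpwardsPathIn S v ∧ ∀ (m : ℕ) (w : Fin m → α), IsUpwardsPathIn S w → m ≤ n

end Paths

/-- The poset `P̂ = P ∪ {-∞, ∞}`, with `-∞ = ⊥` and `∞ = ⊤`. -/
abbrev Hat (P : Type*) : Type _ := WithBot (WithTop P)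

/-! ### The canonical module, its dual, and their gradings -/

section Canonical

variable (k : Type*) [Field k] (A : Type*) [CommRing A] [Algebra k A]

/-- Kähler differentials of top degree: `⋀^d Ω_{A/k}`, where `d` is the transcendence degree of
`A` over `k`, i.e. the dimension of `A` when `A` is a domain that is finitely generated
over `k`. -/
abbrev TopForms : Type _ := ⋀[A]^(Cardinal.toNat (Algebra.trdeg k A)) (Ω[A⁄k])

/-- The canonical module `ω_A = (⋀^d Ω_{A/k})^{**}` of a (geometrically) normal domain `A`,
finitely generated over `k`: the reflexive hull of the module of top differentials, i.e. the
divisorial module of a canonical divisor. -/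
abbrev CanonicalModule : Type _ := Module.Dual A (Module.Dual A (TopForms k A))

/-- The anticanonical module `ω_A^{(-1)} = Hom_A(ω_A, A)`. -/
abbrev AnticanonicalModule : Type _ := Module.Dual A (CanonicalModule k A)

/-- A normal Cohen-Macaulay domain `A`, finitely generated over `k` (such as a normal affine
toric ring), is Gorenstein if a canonical divisor is Cartier, i.e. if its canonical module is
invertible (locally free of rank one). -/
def IsGorenstein : Prop := Module.Invertible A (CanonicalModule k A)

variable {A}

/-- The elements of degree `i` of the dual of a graded module: the linear forms raising degrees
by `i`. -/
def dualDegree (𝒜 : ℤ → AddSubgroup A) {M : Type*} [AddCommGroup M] [Module A M]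
    (ℳ : ℤ → AddSubgroup M) (i : ℤ) : AddSubgroup (Module.Dual A M) where
  carrier := {φ | ∀ (j : ℤ), ∀ x ∈ ℳ j, φ x ∈ 𝒜 (j + i)}
  zero_mem' := fun j _ _ => (𝒜 (j + i)).zero_mem
  add_mem' := fun hφ hψ j x hx => (𝒜 (j + i)).add_mem (hφ j x hx) (hψ j x hx)
  neg_mem' := fun hφ j x hx => (𝒜 (j + i)).neg_mem (hφ j x hx)

/-- The top differentials of degree `i`: sums of `a · db₁ ∧ ⋯ ∧ db_d` with `a, b₁, …, b_d`
homogeneous of degrees adding up to `i` (so that `d : A → Ω_{A/k}` preserves degrees). -/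
def topFormsDegree (𝒜 : ℤ → AddSubgroup A) (i : ℤ) : AddSubgroup (TopForms k A) :=
  AddSubgroup.closure
    {η | ∃ (a : A) (b : Fin (Cardinal.toNat (Algebra.trdeg k A)) → A) (r : ℤ)
        (e : Fin (Cardinal.toNat (Algebra.trdeg k A)) → ℤ),
      a ∈ 𝒜 r ∧ (∀ j, b j ∈ 𝒜 (e j)) ∧ r + ∑ j, e j = i ∧
        η = a • exteriorPower.ιMulti A _ (fun j => KaehlerDifferential.D k A (b j))}

/-- The homogeneous elements of degree `i` of the canonical module. -/
def canonicalDegree (𝒜 : ℤ → AddSubgroup A) : ℤ → AddSubgroup (CanonicalModule k A) :=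
  dualDegree 𝒜 (dualDegree 𝒜 (topFormsDegree k 𝒜))

/-- The homogeneous elements of degree `i` of the anticanonical module. -/
def anticanonicalDegree (𝒜 : ℤ → AddSubgroup A) : ℤ → AddSubgroup (AnticanonicalModule k A) :=
  dualDegree 𝒜 (canonicalDegree k 𝒜)

/-- `A`, graded by `𝒜`, is `ω^{(-1)}`-level: the anticanonical module is generated over `A` by
its homogeneous elements of a single degree. -/
def IsAnticanonicalLevel (𝒜 : ℤ → AddSubgroup A) : Prop :=
  ∃ m : ℤ, Submodule.span A (anticanonicalDegree k 𝒜 m : Set (AnticanonicalModule k A)) = ⊤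

end Canonical

/-! ### Hibi rings -/

section Ring

variable (k : Type*) [Field k] (P : Type*) [PartialOrder P] [Fintype P]

variable {P} in
open Classical in
/-- The monomial `x_I = t ∏_{v ∈ I} x_v` of a poset ideal `I`; the variable `t` is `X none` and
`x_v` is `X (some v)`. -/
def idealMonomial (I : LowerSet P) : MvPolynomial (Option P) k :=
  MvPolynomial.X none * ∏ v : P with v ∈ I, MvPolynomial.X (some v)

/-- The Hibi ring `R_k[I(P)]`, generated over `k` by the monomials of all poset ideals. -/
def hibiRing : Subalgebra k (MvPolynomial (Option P) k) :=
  Algebra.adjoin k (Set.range (idealMonomial (P := P) k))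

/-- The weight which is `1` on `t` and `0` on each `x_v`. -/
def tWeight : Option P → ℤ
  | none => 1
  | some _ => 0

/-- The grading of the Hibi ring by the degree in `t`. -/
def hibiDegree (i : ℤ) : AddSubgroup (hibiRing k P) :=
  ((MvPolynomial.weightedHomogeneousSubmodule k (tWeight P) i).comap
    (hibiRing k P).val.toLinearMap).toAddSubgroup

end Ring

end Hibi

end

/-!
Write `R` for the Hibi ring, `N` for its module of top differentials and `s` for the sum of the
exponents of a maximal chain of poset ideals `I_0 ⊂ ⋯ ⊂ I_n`.

*From modules to weights.* A monomial lies in `R` exactly when its exponent, read as a function on `P̂`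
which vanishes at `∞`, is antitone (`mem_hibiRing_iff`). The monomials of a maximal chain generate
the fraction field, so `N` has rank one and a linear form `ψ` on `N` is determined by its value at
`dx_{I_0} ∧ ⋯ ∧ dx_{I_n}` (`IsDifferentiallyGenerating.apply_mul_apply`). The determinant of the
Euler derivations is one such form; on a maximal chain it is a triangular determinant and equals
the monomial of the chain, and all its values lie in every facet ideal. Comparing `ψ` with it shows
that the values `ψ(dx_{I_0} ∧ ⋯ ∧ dx_{I_n})` are spanned by the monomials with exponent `s + ν`,
where `ν` is a *weight*: `ν(∞) = 0` and `ν(y) ≤ ν(x) + 1` whenever `y` covers `x`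
(`isWeight_of_mem_formValues`, `exists_mono_mem_formValues`). The inequality for a given cover
`x ⋖ y` uses a chain in which exactly one ideal contains `x` but not `y`. Dualizing the evaluation
map `N → N^{**}` makes `Hom(N, R)` a quotient of the anticanonical module, compatibly with degrees,
so levelness says that each weight is an antitone function plus a weight of one fixed degree
(`exists_weight_of_isAnticanonicalLevel`).

*Combinatorics of weights.* The weights `ν` of least degree `ν(-∞) = -dist(-∞, ∞)` must equal
`-dist(·, ∞)` on the elements of minimal length paths. If `u ≤ w` are two such elements, levelness
applied to a weight with `ν(w) - ν(u) ≥ dist(u, w)` yields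
`dist(u, w) + dist(w, ∞) ≤ dist(u, ∞)` (`dist_add_dist_le`). If no element is nonminimal, this
inequality at covers says that `dist(·, ∞)` drops by exactly one along each cover; then
`-dist(·, ∞)` is tight at every facet, so `Hom(N, R)` is free and `R` is Gorenstein
(`isGorenstein_of_dist_eq`). Otherwise extend a longest path `v_1, …, v_k` of nonminimal elements by
some `v_0` below and some `y` above it. By maximality both are minimal, and `dist(v_0, y) ≥ 2`, so
`dist(v_k, ∞) ≤ dist(y, ∞) + 1 < dist(v_0, ∞)`; this is the claim, because the sum of the
disparities telescopes (`exists_path_sum_disp_lt`).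
-/

noncomputable section

namespace Hibi

/-! ### Weights and distances along upwards paths -/

section Weights

variable {α : Type*} [PartialOrder α]

/-- A weight is a function which vanishes at `⊤` and increases by at most `1` along every cover.
On `P̂` these are the exponents of the monomials which span the anticanonical module of the Hibi ring. -/
def IsWeight [OrderTop α] (ν : α → ℤ) : Prop :=
  ν ⊤ = 0 ∧ ∀ x y, x ⋖ y → ν y ≤ ν x + 1

theorem IsUpwardsPathFromTo.le_add {n : ℕ} {v : Fin (n + 1) → α} {a b : α}
    (hv : IsUpwardsPathFromTo v a b) {f : α → ℤ} (hf : ∀ x y, x ⋖ y → y ≤ b → f y ≤ f x + 1)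
    {i j : ℕ} (hij : i ≤ j) (hj : j < n + 1) :
    f (v ⟨j, hj⟩) ≤ f (v ⟨i, hij.trans_lt hj⟩) + (j - i) ∧ v ⟨j, hj⟩ ≤ b := by
  have hle : ∀ j (hj : j < n + 1), v ⟨j, hj⟩ ≤ b := by
    intro j hj
    induction (Nat.lt_succ_iff.mp hj) using Nat.decreasingInduction with
    | self => exact hv.2.2.le
    | of_succ k hk ih => exact (hv.1.2 k (by omega)).le.trans (ih (by omega))
  refine ⟨?_, hle j hj⟩
  induction j, hij using Nat.le_induction with
  | base => simp
  | succ j hij ih =>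
    have h1 := hf _ _ (hv.1.2 j hj) (hle _ _)
    have h2 := ih (by omega)
    push_cast
    linarith

theorem IsUpwardsPathFromTo.apply_le {n : ℕ} {v : Fin (n + 1) → α} {a b : α}
    (hv : IsUpwardsPathFromTo v a b) {f : α → ℤ} (hf : ∀ x y, x ⋖ y → y ≤ b → f y ≤ f x + 1) :
    f b ≤ f a + n := by
  have h := (hv.le_add hf (Nat.zero_le n) (Nat.lt_succ_self n)).1
  have h0 : v ⟨0, Nat.succ_pos n⟩ = a := hv.2.1
  have h1 : v ⟨n, Nat.lt_succ_self n⟩ = b := hv.2.2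
  rw [h0, h1] at h
  simpa using h

theorem isUpwardsPathFromTo_refl (a : α) : IsUpwardsPathFromTo (fun _ : Fin 1 => a) a a :=
  ⟨⟨Nat.one_pos, fun i h => by omega⟩, rfl, rfl⟩

theorem IsUpwardsPath.cons {n : ℕ} {v : Fin n → α} (hv : IsUpwardsPath v) {a : α}
    (ha : a ⋖ v ⟨0, hv.1⟩) : IsUpwardsPath (Fin.cons a v : Fin (n + 1) → α) := by
  refine ⟨n.succ_pos, fun i h => ?_⟩
  cases i with
  | zero => exact ha
  | succ i => exact hv.2 i (by omega)

theorem IsUpwardsPath.snoc {n : ℕ} {v : Fin n → α} (hv : IsUpwardsPath v) {b : α}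
    (hb : v ⟨n - 1, Nat.sub_lt hv.1 Nat.one_pos⟩ ⋖ b) :
    IsUpwardsPath (Fin.snoc v b : Fin (n + 1) → α) := by
  refine ⟨n.succ_pos, fun i h => ?_⟩
  have hi : i < n := by omega
  rcases Nat.lt_or_ge (i + 1) n with h1 | h1
  · simpa [Fin.snoc, hi, h1] using hv.2 i h1
  · obtain rfl : i = n - 1 := by omega
    simpa [Fin.snoc, hi, h1.not_gt] using hb

theorem IsUpwardsPathFromTo.cons {n : ℕ} {v : Fin (n + 1) → α} {a b c : α}
    (hv : IsUpwardsPathFromTo v b c) (hab : a ⋖ b) :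
    IsUpwardsPathFromTo (Fin.cons a v : Fin (n + 2) → α) a c := by
  refine ⟨hv.1.cons (hv.2.1 ▸ hab), rfl, ?_⟩
  rw [← hv.2.2]
  rfl

theorem IsUpwardsPath.strictMono {n : ℕ} {v : Fin n → α} (hv : IsUpwardsPath v) :
    StrictMono v := by
  obtain ⟨n, rfl⟩ : ∃ m, n = m + 1 := ⟨n - 1, by have := hv.1; omega⟩
  exact Fin.strictMono_iff_lt_succ.2 fun i => (hv.2 i (by omega)).lt

theorem IsUpwardsPathFromTo.dist_le {n : ℕ} {v : Fin (n + 1) → α} {a b : α}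
    (hv : IsUpwardsPathFromTo v a b) : dist a b ≤ n :=
  Nat.sInf_le ⟨v, hv⟩

theorem dist_self (a : α) : dist a a = 0 :=
  Nat.le_zero.1 (isUpwardsPathFromTo_refl a).dist_le

section Finite

variable [Finite α]

theorem exists_isUpwardsPathFromTo {a b : α} (hab : a ≤ b) :
    ∃ (n : ℕ) (v : Fin (n + 1) → α), IsUpwardsPathFromTo v a b := by
  induction a using WellFoundedGT.induction with
  | ind a ih =>
    rcases hab.eq_or_lt with rfl | hlt
    · exact ⟨0, _, isUpwardsPathFromTo_refl a⟩
    · obtain ⟨x, hax, hxb⟩ := exists_covBy_le_of_lt hlt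
      obtain ⟨n, v, hv⟩ := ih x hax.lt hxb
      exact ⟨_, _, hv.cons hax⟩

theorem exists_isUpwardsPathFromTo_dist {a b : α} (hab : a ≤ b) :
    ∃ v : Fin (dist a b + 1) → α, IsUpwardsPathFromTo v a b :=
  Nat.sInf_mem (s := {n : ℕ | ∃ v : Fin (n + 1) → α, IsUpwardsPathFromTo v a b})
    (exists_isUpwardsPathFromTo hab)

theorem dist_le_dist_add_one {a b c : α} (hab : a ⋖ b) (hbc : b ≤ c) :
    dist a c ≤ dist b c + 1 := by
  obtain ⟨v, hv⟩ := exists_isUpwardsPathFromTo_dist hbc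
  exact (hv.cons hab).dist_le

theorem CovBy.dist_le_one {a b : α} (hab : a ⋖ b) : dist a b ≤ 1 := by
  simpa [dist_self] using dist_le_dist_add_one hab le_rfl

theorem eq_of_dist_eq_zero {a b : α} (hab : a ≤ b) (h : dist a b = 0) : a = b := by
  obtain ⟨v, hv⟩ := exists_isUpwardsPathFromTo_dist hab
  have h0 : (0 : Fin (dist a b + 1)) = Fin.last _ := by
    ext
    simp [h]
  exact hv.2.1.symm.trans ((congrArg v h0).trans hv.2.2)

theorem covBy_of_dist_eq_one {a b : α} (hab : a ≤ b) (h : dist a b = 1) : a ⋖ b := by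
  obtain ⟨v, hv⟩ := exists_isUpwardsPathFromTo_dist hab
  have h1 := hv.1.2 0 (by omega)
  have h2 : (⟨0 + 1, by omega⟩ : Fin (dist a b + 1)) = Fin.last _ := by
    ext
    simp [h]
  rw [h2, hv.2.2] at h1
  exact hv.2.1 ▸ h1

theorem IsWeight.le_add_dist [OrderTop α] {ν : α → ℤ} (hν : IsWeight ν) {a b : α} (hab : a ≤ b) :
    ν b ≤ ν a + dist a b := by
  obtain ⟨v, hv⟩ := exists_isUpwardsPathFromTo_dist hab
  exact hv.apply_le fun x y h _ => hν.2 x y h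

theorem IsWeight.neg_dist_le [OrderTop α] {ν : α → ℤ} (hν : IsWeight ν) (a : α) :
    -(dist a ⊤ : ℤ) ≤ ν a := by
  have := hν.le_add_dist (le_top (a := a))
  rw [hν.1] at this
  linarith

theorem isWeight_neg_dist [OrderTop α] : IsWeight fun a : α => -(dist a ⊤ : ℤ) := by
  refine ⟨by simp [dist_self], fun x y h => ?_⟩
  have := dist_le_dist_add_one h (le_top (a := y))
  push_cast
  linarith [(Nat.cast_le (α := ℤ)).2 this]

/-- A weight of the least possible value at `⊥` is forced to be `-dist(·, ⊤)` on `minSubset`. -/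
theorem IsWeight.eq_neg_dist [BoundedOrder α] {ν : α → ℤ} (hν : IsWeight ν)
    (hbot : ν ⊥ ≤ -(dist (⊥ : α) ⊤ : ℤ)) {x : α} (hx : x ∈ minSubset α) :
    ν x = -(dist x ⊤ : ℤ) := by
  refine le_antisymm ?_ (hν.neg_dist_le x)
  obtain ⟨n, v, ⟨hv, hmin⟩, ⟨i, hi⟩, rfl⟩ := hx
  obtain ⟨w, hw⟩ := exists_isUpwardsPathFromTo_dist (bot_le (a := (⊤ : α)))
  have hn : (n : ℤ) ≤ dist (⊥ : α) ⊤ := by exact_mod_cast hmin _ w hw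
  have h1 := (hv.le_add (fun x y h _ => hν.2 x y h) (Nat.zero_le i) hi).1
  have h0 : v ⟨0, Nat.succ_pos n⟩ = ⊥ := hv.2.1
  have h2 := (hv.le_add (fun x y h _ => (isWeight_neg_dist (α := α)).2 x y h)
    (Nat.lt_succ_iff.1 hi) n.lt_succ_self).1
  have hl : v ⟨n, Nat.lt_succ_self n⟩ = ⊤ := hv.2.2
  rw [h0] at h1
  simp only [hl, dist_self] at h2
  push_cast at h1 h2
  linarith

/-- The combinatorial form of levelness forces all disparities inside `minSubset` to vanish: the
weight `max (-dist(z, ⊤)) (dist(u, w) - dist(z, w))` (second term only for `z ≤ w`) drops by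
`dist(u, w)` between `w` and `u`, hence so does the weight of least degree below it. -/
theorem dist_add_dist_le [BoundedOrder α] {m : ℤ}
    (hlevel : ∀ ν : α → ℤ, IsWeight ν → ∃ ν₀, IsWeight ν₀ ∧ ν₀ ⊥ = m ∧ Antitone (ν - ν₀))
    {u w : α} (hu : u ∈ minSubset α) (hw : w ∈ minSubset α) (huw : u ≤ w) :
    dist u w + dist w ⊤ ≤ dist u ⊤ := by
  classical
  rcases eq_or_ne w ⊤ with rfl | hwt
  · simp [dist_self]
  have hm : m ≤ -(dist (⊥ : α) ⊤ : ℤ) := by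
    obtain ⟨ν₀, h1, h2, h3⟩ := hlevel _ isWeight_neg_dist
    have := h3 (bot_le (a := (⊤ : α)))
    simp only [Pi.sub_apply, h1.1, h2, dist_self] at this
    simpa using this
  let ν : α → ℤ := fun z =>
    if z ≤ w then max (-(dist z ⊤ : ℤ)) (dist u w - dist z w) else -(dist z ⊤ : ℤ)
  have hge : ∀ z, -(dist z ⊤ : ℤ) ≤ ν z := fun z => by
    simp only [ν]
    split_ifs
    exacts [le_max_left _ _, le_rfl]
  have hν : IsWeight ν := by
    refine ⟨by simp [ν, hwt, dist_self], fun x y h => ?_⟩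
    have h1 := dist_le_dist_add_one h (le_top (a := y))
    have h2 := hge x
    by_cases hy : y ≤ w
    · have hx : x ≤ w := h.le.trans hy
      have h3 := dist_le_dist_add_one h hy
      have h4 : (dist u w : ℤ) - dist x w ≤ ν x := by
        simp only [ν, hx, if_true]
        exact le_max_right _ _
      have h5 : ν y = max (-(dist y ⊤ : ℤ)) (dist u w - dist y w) := if_pos hy
      rw [h5]
      apply max_le <;> omega
    · have h5 : ν y = -(dist y ⊤ : ℤ) := if_neg hy
      rw [h5]
      omega
  obtain ⟨ν₀, h1, h2, h3⟩ := hlevel ν hν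
  have h4 := h3 huw
  simp only [Pi.sub_apply] at h4
  rw [h1.eq_neg_dist (h2.trans_le hm) hu, h1.eq_neg_dist (h2.trans_le hm) hw] at h4
  have h5 : ν u = 0 := by simp [ν, huw]
  have h6 : (dist u w : ℤ) ≤ ν w := by simp [ν, dist_self]
  omega

theorem bot_top_mem_minSubset [BoundedOrder α] : (⊥ : α) ∈ minSubset α ∧ (⊤ : α) ∈ minSubset α := by
  obtain ⟨v, hv⟩ := exists_isUpwardsPathFromTo_dist (bot_le (a := (⊤ : α)))
  have hmin : IsMinimalLengthPath v ⊥ ⊤ := ⟨hv, fun m w hw => hw.dist_le⟩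
  exact ⟨⟨_, v, hmin, 0, hv.2.1⟩, ⟨_, v, hmin, Fin.last _, hv.2.2⟩⟩

theorem exists_isMaximalLengthUpwardsPathIn {S : Set α} (hS : S.Nonempty) :
    ∃ (n : ℕ) (v : Fin n → α), IsMaximalLengthUpwardsPathIn S v := by
  classical
  obtain ⟨x, hx⟩ := hS
  cases nonempty_fintype α
  let p : ℕ → Prop := fun n => ∃ v : Fin n → α, IsUpwardsPathIn S v
  have hp : ∀ n, p n → n ≤ Fintype.card α := by
    rintro n ⟨v, hv, -⟩
    simpa using Fintype.card_le_of_injective v hv.strictMono.injective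
  have h1 : p 1 := ⟨fun _ => x, (isUpwardsPathFromTo_refl x).1, fun _ => hx⟩
  obtain ⟨v, hv⟩ : p (Nat.findGreatest p (Fintype.card α)) := Nat.findGreatest_spec (hp 1 h1) h1
  exact ⟨_, v, hv, fun m w hw => Nat.le_findGreatest (hp m ⟨w, hw⟩) ⟨w, hw⟩⟩

/-- A longest path in `nonminSubset`, extended by one element downwards, has small total disparity
once disparities vanish on `minSubset`: the elements just below and just above the path both lie
in `minSubset`, and they are at distance at least `2`. -/
theorem exists_path_sum_disp_lt [BoundedOrder α]
    (hdist : ∀ u w : α, u ∈ minSubset α → w ∈ minSubset α → u ≤ w →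
      dist u w + dist w ⊤ ≤ dist u ⊤)
    (hne : (nonminSubset α).Nonempty) :
    ∃ (n : ℕ) (v : Fin (n + 1) → α), IsUpwardsPath v ∧
      IsMaximalLengthUpwardsPathIn (nonminSubset α) (Fin.tail v) ∧
      ∑ i : Fin n, disp (v i.castSucc) (v i.succ) < (n : ℤ) := by
  obtain ⟨n, v, hv, hmax⟩ := exists_isMaximalLengthUpwardsPathIn hne
  have hn : 0 < n := hv.1.1
  set a := v ⟨0, hn⟩ with ha
  set b := v ⟨n - 1, Nat.sub_lt hn Nat.one_pos⟩ with hb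
  have hab : a ≤ b := hv.1.strictMono.monotone (by simp)
  have ha0 : ⊥ < a := bot_lt_iff_ne_bot.2 fun h => hv.2 ⟨0, hn⟩ (by
    rw [← ha, h]; exact bot_top_mem_minSubset.1)
  have hb0 : b < ⊤ := lt_top_iff_ne_top.2 fun h => hv.2 ⟨n - 1, Nat.sub_lt hn Nat.one_pos⟩ (by
    rw [← hb, h]; exact bot_top_mem_minSubset.2)
  obtain ⟨z, -, hza⟩ := exists_le_covBy_of_lt ha0
  obtain ⟨y, hby, -⟩ := exists_covBy_le_of_lt hb0
  have hz : z ∈ minSubset α := by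
    by_contra hz
    refine absurd (hmax _ _ ⟨hv.1.cons hza, fun i => ?_⟩) (by omega)
    refine Fin.cases hz (fun i => ?_) i
    simpa using hv.2 i
  have hy : y ∈ minSubset α := by
    by_contra hy
    refine absurd (hmax _ _ ⟨hv.1.snoc hby, fun i => ?_⟩) (by omega)
    refine Fin.lastCases ?_ (fun i => ?_) i
    · simpa [nonminSubset] using hy
    · simpa using hv.2 i
  have hzy : z < y := (hza.lt.trans_le hab).trans hby.lt
  have h2 : 2 ≤ dist z y := by
    by_contra! h
    rcases Nat.lt_or_ge (dist z y) 1 with h0 | h1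
    · exact hzy.ne (eq_of_dist_eq_zero hzy.le (by omega))
    · exact (covBy_of_dist_eq_one hzy.le (by omega)).2 hza.lt (hab.trans_lt hby.lt)
  have h3 := hdist z y hz hy hzy.le
  have h4 := dist_le_dist_add_one hby (le_top (a := y))
  have hpath := hv.1.cons hza
  refine ⟨n, Fin.cons z v, hpath, by simpa using ⟨hv, hmax⟩, ?_⟩
  set p : Fin (n + 1) → α := Fin.cons z v with hp
  -- Each cover has `dist ≤ 1`, so the sum of disparities telescopes.
  have hsum : ∑ i : Fin n, disp (p i.castSucc) (p i.succ) ≤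
      ∑ i : Fin n, (1 + ((dist (p i.succ) ⊤ : ℤ) - dist (p i.castSucc) ⊤)) := by
    refine Finset.sum_le_sum fun i _ => ?_
    have hc : p i.castSucc ⋖ p i.succ := hpath.2 i (by omega)
    have := CovBy.dist_le_one hc
    simp only [disp]
    omega
  have htel : ∑ i : Fin n, ((dist (p i.succ) ⊤ : ℤ) - dist (p i.castSucc) ⊤) =
      dist (p (Fin.last n)) ⊤ - dist (p 0) ⊤ := by
    have h1 := Fin.sum_univ_succ fun i => (dist (p i) ⊤ : ℤ)
    rw [Fin.sum_univ_castSucc] at h1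
    rw [Finset.sum_sub_distrib]
    linarith
  have hlast : p (Fin.last n) = b := by
    obtain ⟨l, rfl⟩ : ∃ l, n = l + 1 := ⟨n - 1, by omega⟩
    rw [← Fin.succ_last, hp, Fin.cons_succ]
    rfl
  have h0 : p 0 = z := rfl
  rw [Finset.sum_add_distrib, htel, hlast, h0] at hsum
  simp only [Finset.sum_const, Finset.card_univ, Fintype.card_fin, nsmul_eq_mul, mul_one] at hsum
  omega

theorem dist_eq_add_one_of_covBy [BoundedOrder α]
    (hdist : ∀ u w : α, u ∈ minSubset α → w ∈ minSubset α → u ≤ w →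
      dist u w + dist w ⊤ ≤ dist u ⊤)
    (hempty : ¬ (nonminSubset α).Nonempty) {x y : α} (h : x ⋖ y) :
    dist x ⊤ = dist y ⊤ + 1 := by
  have hmem : ∀ z : α, z ∈ minSubset α := fun z => by
    by_contra hz
    exact hempty ⟨z, hz⟩
  have h1 := hdist x y (hmem x) (hmem y) h.le
  have h2 := dist_le_dist_add_one h (le_top (a := y))
  have h3 : dist x y ≠ 0 := fun h0 => h.ne (eq_of_dist_eq_zero h.le h0)
  omega

end Finite

end Weights

/-! ### Monomials of the Hibi ring -/

section Exponents

variable {P : Type*}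

/-- The exponent variables as elements of `P̂`: the variable `t` corresponds to `-∞`. -/
def toHat : Option P → Hat P
  | none => ⊥
  | some v => ((v : WithTop P) : Hat P)

/-- An exponent vector as a function on `P̂`, with the value `0` at `∞` and the exponent of `t`
at `-∞`. -/
def height (a : Option P →₀ ℕ) : Hat P → ℤ
  | none => a none
  | some none => 0
  | some (some v) => a (some v)

@[simp] theorem height_toHat (a : Option P →₀ ℕ) (i : Option P) : height a (toHat i) = a i := by
  cases i <;> rfl

@[simp] theorem height_top [PartialOrder P] (a : Option P →₀ ℕ) : height a ⊤ = 0 := rfl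

@[simp] theorem height_bot (a : Option P →₀ ℕ) : height a ⊥ = a none := rfl

theorem eq_top_or_eq_toHat [PartialOrder P] (x : Hat P) : x = ⊤ ∨ ∃ i, x = toHat i := by
  match x with
  | none => exact Or.inr ⟨none, rfl⟩
  | some none => exact Or.inl rfl
  | some (some v) => exact Or.inr ⟨some v, rfl⟩

theorem toHat_injective : Function.Injective (toHat : Option P → Hat P) := by
  rintro (_ | v) (_ | w) h
  · rfl
  · cases h
  · cases h
  · cases h; rfl

theorem toHat_ne_top [PartialOrder P] (i : Option P) : toHat i ≠ ⊤ := by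
  cases i <;> intro h <;> cases h

theorem height_add (a b : Option P →₀ ℕ) : height (a + b) = height a + height b := by
  ext x
  match x with
  | none => exact Nat.cast_add _ _
  | some none => rfl
  | some (some v) => exact Nat.cast_add _ _

theorem height_injective : Function.Injective (height : (Option P →₀ ℕ) → Hat P → ℤ) := by
  intro a b h
  ext i
  have := congrFun h (toHat i)
  simpa using this

theorem height_nonneg (a : Option P →₀ ℕ) (x : Hat P) : 0 ≤ height a x := by
  match x with
  | none => exact Int.natCast_nonneg _
  | some none => exact le_rfl
  | some (some v) => exact Int.natCast_nonneg _

theorem exists_height_eq [PartialOrder P] [Finite P] {q : Hat P → ℤ} (hq : Antitone q)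
    (htop : q ⊤ = 0) : ∃ a : Option P →₀ ℕ, height a = q := by
  refine ⟨Finsupp.equivFunOnFinite.symm fun i => (q (toHat i)).toNat, ?_⟩
  ext x
  rcases eq_top_or_eq_toHat x with rfl | ⟨i, rfl⟩
  · simp [htop]
  · have : 0 ≤ q (toHat i) := htop ▸ hq le_top
    simp [this]

theorem antitone_of_covBy {α : Type*} [PartialOrder α] [Finite α] {q : α → ℤ}
    (h : ∀ x y, x ⋖ y → q y ≤ q x) : Antitone q := by
  classical
  cases nonempty_fintype α
  let : LocallyFiniteOrder α := Fintype.toLocallyFiniteOrder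
  exact (antitone_iff_forall_covBy q).2 fun x y => h x y

theorem apply_some_le [PartialOrder P] {a : Option P →₀ ℕ} (ha : Antitone (height a)) {v w : P}
    (h : v ≤ w) : a (some w) ≤ a (some v) := by
  have : (toHat (some v)) ≤ toHat (some w) := by simpa [toHat] using h
  simpa using ha this

theorem le_apply_none [PartialOrder P] {a : Option P →₀ ℕ} (ha : Antitone (height a))
    (i : Option P) : a i ≤ a none := by
  have := ha (bot_le (a := toHat i))
  simpa using this

theorem antitone_height_add [PartialOrder P] {a b : Option P →₀ ℕ} (ha : Antitone (height a))
    (hb : Antitone (height b)) : Antitone (height (a + b)) := by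
  rw [height_add]
  exact ha.add hb

theorem antitone_height_zero [PartialOrder P] : Antitone (height (0 : Option P →₀ ℕ)) := by
  have : height (0 : Option P →₀ ℕ) = 0 := by
    have h := height_add (0 : Option P →₀ ℕ) 0
    rw [add_zero] at h
    simpa using h
  rw [this]
  exact antitone_const

/-- The level sets of an exponent vector decompose it into indicator vectors. -/
theorem eq_sum_levels [Fintype P] (a : Option P →₀ ℕ) (ha : ∀ i, a i ≤ a none) :
    a = ∑ r ∈ Finset.Icc 1 (a none),
      Finsupp.equivFunOnFinite.symm fun i => if r ≤ a i then 1 else 0 := by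
  ext i
  have h : (Finset.Icc 1 (a none)).filter (fun r => r ≤ a i) = Finset.Icc 1 (a i) := by
    ext r
    have := ha i
    simp only [Finset.mem_filter, Finset.mem_Icc]
    omega
  rw [Finsupp.finsetSum_apply]
  simp only [Finsupp.equivFunOnFinite_symm_apply_apply]
  rw [← Finset.sum_filter, h]
  simp

end Exponents

open MvPolynomial in
theorem coeff_X_mul_pderiv {σ k : Type*} [CommSemiring k] (i : σ)
    (f : MvPolynomial σ k) (a : σ →₀ ℕ) :
    coeff a (X i * pderiv i f) = (a i : k) * coeff a f := by
  classical
  induction f using MvPolynomial.induction_on' with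
  | monomial b r =>
    rw [X_mul_pderiv_monomial, coeff_smul, coeff_monomial]
    split_ifs with h
    · subst h
      simp
    · simp
  | add f g hf hg => simp [mul_add, hf, hg]

section Ring

variable (k : Type*) [Field k] {P : Type*} [PartialOrder P] [Fintype P]

open MvPolynomial

theorem idealMonomial_eq_monomial (I : LowerSet P) {a : Option P →₀ ℕ} (h0 : a none = 1)
    (h1 : ∀ v ∈ I, a (some v) = 1) (h2 : ∀ v ∉ I, a (some v) = 0) :
    idealMonomial k I = monomial a 1 := by
  classical
  rw [monomial_eq, C_1, one_mul, Finsupp.prod_fintype _ _ (fun i => pow_zero _),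
    Fintype.prod_option, h0, pow_one, idealMonomial, Finset.prod_filter]
  congr 1
  refine Finset.prod_congr rfl fun v _ => ?_
  split_ifs with hv
  · rw [h1 v hv, pow_one]
  · rw [h2 v hv, pow_zero]

theorem monomial_mem_hibiRing {a : Option P →₀ ℕ} (ha : Antitone (height a)) :
    monomial a (1 : k) ∈ hibiRing k P := by
  rw [eq_sum_levels a (le_apply_none ha), monomial_sum_one]
  refine Subalgebra.prod_mem _ fun r hr => ?_
  rw [Finset.mem_Icc] at hr
  let I : LowerSet P := ⟨{v | r ≤ a (some v)}, fun w v h hw =>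
    (show r ≤ a (some w) from hw).trans (apply_some_le ha h)⟩
  have hI : ∀ v, v ∈ I ↔ r ≤ a (some v) := fun v => Iff.rfl
  rw [← idealMonomial_eq_monomial k I]
  · exact Algebra.subset_adjoin ⟨I, rfl⟩
  · simp [hr.2]
  · intro v hv
    simp [(hI v).1 hv]
  · intro v hv
    simpa using fun h => hv ((hI v).2 h)

/-- The Hibi ring is the monoid algebra of the antitone functions on `P̂` vanishing at `∞`. -/
theorem mem_hibiRing_iff {f : MvPolynomial (Option P) k} :
    f ∈ hibiRing k P ↔ ∀ a ∈ f.support, Antitone (height a) := by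
  classical
  constructor
  · intro hf
    induction hf using Algebra.adjoin_induction with
    | mem f hf =>
      obtain ⟨I, rfl⟩ := hf
      let b : Option P →₀ ℕ := Finsupp.equivFunOnFinite.symm fun
        | none => 1
        | some v => if v ∈ I then 1 else 0
      intro a ha
      rw [idealMonomial_eq_monomial k I (a := b) rfl (fun v hv => by simp [b, hv])
        (fun v hv => by simp [b, hv])] at ha
      obtain rfl : a = b := by simpa using support_monomial_subset ha
      intro x y hxy
      match x, y with
      | _, some none => exact height_nonneg _ _
      | none, none => exact le_rfl
      | none, some (some w) =>
        simp only [height, b, Finsupp.equivFunOnFinite_symm_apply_apply]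
        split_ifs <;> simp
      | some _, none => exact absurd hxy (WithBot.not_coe_le_bot _)
      | some none, some (some w) =>
        have : (⊤ : WithTop P) ≤ (w : WithTop P) := WithBot.coe_le_coe.1 hxy
        simp at this
      | some (some v), some (some w) =>
        have h1 : (v : WithTop P) ≤ (w : WithTop P) := WithBot.coe_le_coe.1 hxy
        have h2 : v ≤ w := WithTop.coe_le_coe.1 h1
        simp only [height, b, Finsupp.equivFunOnFinite_symm_apply_apply]
        split_ifs with h3 h4 h4
        · exact le_rfl
        · exact absurd (I.lower h2 h3) h4
        · simp
        · exact le_rfl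
    | algebraMap r =>
      intro a ha
      obtain rfl : a = 0 := by
        have h : algebraMap k (MvPolynomial (Option P) k) r = monomial 0 r := rfl
        rw [h] at ha
        simpa using support_monomial_subset ha
      exact antitone_height_zero
    | add f g _ _ hf hg =>
      intro a ha
      rcases Finset.mem_union.1 (support_add ha) with h | h
      exacts [hf a h, hg a h]
    | mul f g _ _ hf hg =>
      intro a ha
      obtain ⟨b, hb, c, hc, rfl⟩ := Finset.mem_add.1 (support_mul f g ha)
      exact antitone_height_add (hf b hb) (hg c hc)
  · intro h
    rw [f.as_sum]
    refine Subalgebra.sum_mem _ fun a ha => ?_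
    rw [← mul_one (coeff a f), ← smul_eq_mul, ← smul_monomial]
    exact Subalgebra.smul_mem _ (monomial_mem_hibiRing k (h a ha)) _

/-- The monomial with an antitone exponent vector, as an element of the Hibi ring. -/
def mono (a : Option P →₀ ℕ) (ha : Antitone (height a)) : hibiRing k P :=
  ⟨monomial a 1, monomial_mem_hibiRing k ha⟩

variable {k}

theorem mono_ne_zero {a : Option P →₀ ℕ} (ha : Antitone (height a)) : mono k a ha ≠ 0 := by
  intro h
  have := congrArg Subtype.val h
  simp [mono] at this

theorem mono_mul_mono {a b : Option P →₀ ℕ} (ha : Antitone (height a)) (hb : Antitone (height b)) :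
    mono k a ha * mono k b hb = mono k (a + b) (antitone_height_add ha hb) := by
  ext1
  simp [mono, monomial_mul]

/-- An element of the Hibi ring is divisible by a monomial as soon as its exponents stay antitone
after subtraction of the exponent of the monomial. -/
theorem exists_mono_mul_eq {b : Option P →₀ ℕ} (hb : Antitone (height b)) {f : hibiRing k P}
    (h : ∀ a ∈ (f : MvPolynomial (Option P) k).support, Antitone (height a - height b)) :
    ∃ g : hibiRing k P, mono k b hb * g = f := by
  classical
  have key : ∀ a ∈ (f : MvPolynomial (Option P) k).support,
      ∃ c, Antitone (height c) ∧ a = b + c := by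
    intro a ha
    obtain ⟨c, hc⟩ := exists_height_eq (h a ha) (by simp)
    refine ⟨c, hc ▸ h a ha, height_injective ?_⟩
    rw [height_add, hc, add_sub_cancel]
  have hmod : modMonomial (f : MvPolynomial (Option P) k) b = 0 := by
    ext a
    rw [coeff_zero]
    by_cases hba : b ≤ a
    · exact coeff_modMonomial_of_le _ hba
    · rw [coeff_modMonomial_of_not_le _ hba]
      by_contra hne
      obtain ⟨c, -, rfl⟩ := key a (mem_support_iff.2 hne)
      exact hba le_self_add
  obtain ⟨g, hg⟩ := monomial_one_dvd_iff_modMonomial_eq_zero.2 hmod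
  refine ⟨⟨g, (mem_hibiRing_iff k).2 fun c hc => ?_⟩, Subtype.ext hg.symm⟩
  obtain ⟨c', hc', h'⟩ := key (b + c) (by
    rw [mem_support_iff] at hc ⊢
    rwa [hg, coeff_monomial_mul, one_mul])
  rwa [add_left_cancel h']

theorem mem_support_mono_mul {a b : Option P →₀ ℕ} (hb : Antitone (height b)) {f : hibiRing k P}
    (ha : a ∈ (f : MvPolynomial (Option P) k).support) :
    b + a ∈ ((mono k b hb * f : hibiRing k P) : MvPolynomial (Option P) k).support := by
  classical
  rw [mem_support_iff] at ha ⊢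
  simpa [mono, coeff_monomial_mul] using ha

theorem exists_of_mem_support_mono_mul {a b : Option P →₀ ℕ} (hb : Antitone (height b))
    {f : hibiRing k P}
    (ha : a ∈ ((mono k b hb * f : hibiRing k P) : MvPolynomial (Option P) k).support) :
    ∃ c ∈ (f : MvPolynomial (Option P) k).support, a = b + c := by
  classical
  obtain ⟨b', hb', c, hc, rfl⟩ := Finset.mem_add.1 (support_mul _ _ ha)
  obtain rfl : b' = b := by simpa using support_monomial_subset hb'
  exact ⟨c, hc, rfl⟩

theorem span_range_mono :
    Submodule.span k {f : hibiRing k P | ∃ a ha, f = mono k a ha} = ⊤ := by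
  rw [eq_top_iff]
  rintro f -
  have h := (mem_hibiRing_iff k).1 f.2
  have hf : f = ∑ a ∈ (f : MvPolynomial (Option P) k).support.attach,
      coeff a.1 (f : MvPolynomial (Option P) k) • mono k a.1 (h a.1 a.2) := by
    ext1
    conv_lhs => rw [(f : MvPolynomial (Option P) k).as_sum]
    rw [← Finset.sum_attach]
    simp [mono, smul_monomial]
  rw [hf]
  exact Submodule.sum_mem _ fun a _ => Submodule.smul_mem _ _ (Submodule.subset_span ⟨_, _, rfl⟩)

/-! ### Euler derivations and facet ideals -/

variable (k) in
/-- The Euler derivation `x_i ∂/∂x_i` of the Hibi ring. -/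
def euler (i : Option P) : Derivation k (hibiRing k P) (hibiRing k P) :=
  Derivation.mk'
    { toFun := fun f => ⟨X i * pderiv i (f : MvPolynomial (Option P) k),
        (mem_hibiRing_iff k).2 fun a ha => (mem_hibiRing_iff k).1 f.2 a (by
          rw [mem_support_iff, coeff_X_mul_pderiv] at ha
          exact mem_support_iff.2 (right_ne_zero_of_mul ha))⟩
      map_add' := fun f g => by
        ext1
        simp [mul_add]
      map_smul' := fun r f => by
        ext1
        simp }
    fun f g => by
      ext1
      simp only [LinearMap.coe_mk, AddHom.coe_mk, MulMemClass.coe_mul, Derivation.leibniz,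
        smul_eq_mul, AddMemClass.coe_add]
      ring

theorem coeff_euler (i : Option P) (f : hibiRing k P) (a : Option P →₀ ℕ) :
    coeff a (euler k i f : MvPolynomial (Option P) k) =
      (a i : k) * coeff a (f : MvPolynomial (Option P) k) :=
  coeff_X_mul_pderiv i _ a

theorem euler_mono (i : Option P) {a : Option P →₀ ℕ} (ha : Antitone (height a)) :
    euler k i (mono k a ha) = (a i : hibiRing k P) * mono k a ha := by
  classical
  ext1
  ext b
  rw [coeff_euler, MulMemClass.coe_mul]
  have : (((a i : ℕ) : hibiRing k P) : MvPolynomial (Option P) k) = C (a i : k) := by simp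
  rw [this, coeff_C_mul]
  simp only [mono, coeff_monomial]
  split_ifs with h
  · rw [h]
  · simp

variable (k) in
/-- The prime ideal of the facet `x ⋖ y`: the elements whose exponents drop strictly from `x`
to `y`. -/
def facetIdeal (x y : Hat P) (hxy : x ≤ y) : Ideal (hibiRing k P) where
  carrier := {f | ∀ a ∈ (f : MvPolynomial (Option P) k).support, height a y < height a x}
  zero_mem' := by simp
  add_mem' := fun {f g} hf hg a ha => by
    classical
    rcases Finset.mem_union.1 (support_add ha) with h | h
    exacts [hf a h, hg a h]
  smul_mem' := fun f g hg a ha => by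
    classical
    obtain ⟨b, hb, c, hc, rfl⟩ := Finset.mem_add.1 (support_mul _ _ ha)
    have h1 := (mem_hibiRing_iff k).1 f.2 b hb hxy
    have h2 := hg c hc
    rw [height_add]
    exact add_lt_add_of_le_of_lt h1 h2

end Ring

/-! ### Maximal chains of poset ideals -/

theorem height_sum {P ι : Type*} (s : Finset ι) (f : ι → Option P →₀ ℕ) (x : Hat P) :
    height (∑ i ∈ s, f i) x = ∑ i ∈ s, height (f i) x := by
  classical
  induction s using Finset.induction_on with
  | empty =>
    have h := congrFun (height_add (0 : Option P →₀ ℕ) 0) x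
    simp only [add_zero, Pi.add_apply] at h
    simpa using h
  | insert i s hi ih => rw [Finset.sum_insert hi, Finset.sum_insert hi, height_add, Pi.add_apply, ih]

/-- The exponent vector of the poset ideal of all elements up to `i` in the linear order given by
`key`. As `i` varies these are the monomials of a maximal chain of poset ideals. -/
def chainExp {P L : Type*} [Fintype P] [LinearOrder L] (key : Hat P → L) (i : Option P) :
    Option P →₀ ℕ :=
  Finsupp.equivFunOnFinite.symm fun j => if key (toHat j) ≤ key (toHat i) then 1 else 0

theorem chainExp_apply {P L : Type*} [Fintype P] [LinearOrder L] (key : Hat P → L)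
    (i j : Option P) :
    chainExp key i j = if key (toHat j) ≤ key (toHat i) then 1 else 0 := rfl

section Chains

variable {P : Type*} [PartialOrder P]

/-- For a cover `x ⋖ y` in `P̂` there is a linear extension in which `y` comes directly after `x`:
the elements below `y` other than `x` are placed before both, everything else after both. -/
theorem exists_key_of_covBy {x y : Hat P} (h : x ⋖ y) :
    ∃ key : Hat P → ℕ ×ₗ LinearExtension (Hat P), Monotone key ∧ Function.Injective key ∧
      ∀ z, key x ≤ key z → key z < key y → z = x := by
  classical
  let block : Hat P → ℕ := fun z => if z = x then 1 else if z < y then 0 else if z = y then 2 else 3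
  have hblock : Monotone block := by
    intro z w hzw
    by_cases hwx : w = x
    · subst hwx
      rcases hzw.eq_or_lt with rfl | hz
      · exact le_rfl
      · simp [block, hz.ne, hz.trans h.lt]
    · by_cases hwy : w < y
      · have hzx : z ≠ x := by
          rintro rfl
          exact h.2 (lt_of_le_of_ne hzw (Ne.symm hwx)) hwy
        simp [block, hzx, hzw.trans_lt hwy]
      · rcases eq_or_ne w y with rfl | hne
        · rcases hzw.eq_or_lt with rfl | hz
          · exact le_rfl
          · simp only [block, hwx, hwy, hz, if_false, if_true]
            split_ifs <;> simp
        · simp only [block, hwx, hwy, hne, if_false]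
          split_ifs <;> simp
  have hx : block x = 1 := by simp [block]
  have hy : block y = 2 := by simp [block, h.ne']
  refine ⟨fun z => toLex (block z, toLinearExtension z), fun z w hzw => ?_, fun z w hzw => ?_,
    fun z h1 h2 => ?_⟩
  · rcases (hblock hzw).lt_or_eq with hlt | heq
    · exact (Prod.Lex.toLex_le_toLex).2 (Or.inl hlt)
    · exact (Prod.Lex.toLex_le_toLex).2 (Or.inr ⟨heq, toLinearExtension.monotone hzw⟩)
  · exact congrArg Prod.snd (toLex_inj.1 hzw)
  · simp only [Prod.Lex.toLex_le_toLex, Prod.Lex.toLex_lt_toLex, hx, hy] at h1 h2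
    by_contra hne
    have hzy : z ≠ y := by
      rintro rfl
      simp [hy] at h2
    have : block z = 0 ∨ block z = 3 := by
      simp only [block, hne, hzy, if_false]
      split_ifs <;> simp
    omega

variable [Fintype P] {L : Type*} [LinearOrder L]

/-- Exponent vectors which decrease along the linear order of a maximal chain of ideals are sums of
members of that chain. -/
theorem exists_eq_sum_chainExp {key : Hat P → L} (hkey : Monotone key) {a : Option P →₀ ℕ}
    (ha : ∀ i j, key (toHat i) ≤ key (toHat j) → a j ≤ a i) :
    ∃ (s : Finset ℕ) (j : ℕ → Option P), a = ∑ r ∈ s, chainExp key (j r) := by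
  classical
  have hnone : ∀ i, a i ≤ a none := fun i => ha none i (hkey bot_le)
  have hex : ∀ r ∈ Finset.Icc 1 (a none), ∃ j : Option P, r ≤ a j ∧
      ∀ i, r ≤ a i → key (toHat i) ≤ key (toHat j) := by
    intro r hr
    obtain ⟨j, hj, hmax⟩ := Finset.exists_max_image (Finset.univ.filter fun i => r ≤ a i)
      (fun i => key (toHat i)) ⟨none, by simpa using (Finset.mem_Icc.1 hr).2⟩
    exact ⟨j, by simpa using hj, fun i hi => hmax i (by simpa using hi)⟩
  choose! j hj hmax using hex
  refine ⟨Finset.Icc 1 (a none), j, ?_⟩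
  conv_lhs => rw [eq_sum_levels a hnone]
  refine Finset.sum_congr rfl fun r hr => ?_
  ext i
  rw [chainExp_apply]
  simp only [Finsupp.equivFunOnFinite_symm_apply_apply]
  congr 1
  exact propext ⟨hmax r hr i, fun h => (hj r hr).trans (ha _ _ h)⟩

variable {key : Hat P → L} (hkey : Monotone key) (hinj : Function.Injective key)

include hkey hinj

theorem height_chainExp (i : Option P) (x : Hat P) :
    height (chainExp key i) x = if key x ≤ key (toHat i) then 1 else 0 := by
  rcases eq_top_or_eq_toHat x with rfl | ⟨j, rfl⟩
  · have : ¬ key ⊤ ≤ key (toHat i) := fun h =>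
      toHat_ne_top i (hinj (le_antisymm (hkey le_top) h))
    simp [this]
  · simp [chainExp_apply]

theorem antitone_height_chainExp (i : Option P) : Antitone (height (chainExp key i)) := by
  intro x y hxy
  rw [height_chainExp hkey hinj, height_chainExp hkey hinj]
  have := hkey hxy
  split_ifs with h1 h2 h2
  · exact le_rfl
  · exact absurd (this.trans h1) h2
  · simp
  · exact le_rfl

theorem height_sum_chainExp_sub (x y : Hat P) :
    height (∑ i, chainExp key i) x - height (∑ i, chainExp key i) y =
      ∑ i, ((if key x ≤ key (toHat i) then 1 else 0) -
        (if key y ≤ key (toHat i) then 1 else 0) : ℤ) := by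
  simp only [height_sum, height_chainExp hkey hinj, Finset.sum_sub_distrib]

theorem height_sum_chainExp_lt {x y : Hat P} (hxy : key x < key y) :
    height (∑ i, chainExp key i) y < height (∑ i, chainExp key i) x := by
  have hle : ∀ i : Option P, (0 : ℤ) ≤ (if key x ≤ key (toHat i) then 1 else 0) -
      (if key y ≤ key (toHat i) then 1 else 0) := by
    intro i
    split_ifs with h1 h2 h2
    · simp
    · simp
    · exact absurd (hxy.le.trans h2) h1
    · simp
  rw [← sub_pos, height_sum_chainExp_sub hkey hinj]
  refine Finset.sum_pos' (fun i _ => hle i) ?_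
  rcases eq_top_or_eq_toHat x with rfl | ⟨i, rfl⟩
  · exact absurd (hkey le_top) hxy.not_ge
  · exact ⟨i, Finset.mem_univ _, by simp [hxy.not_ge]⟩

theorem antitone_height_sum_chainExp : Antitone (height (∑ i, chainExp key i)) :=
  antitone_of_covBy fun _ _ h =>
    (height_sum_chainExp_lt hkey hinj ((hkey h.le).lt_of_ne (hinj.ne h.ne))).le

/-- A chain given by a linear extension in which `y` directly follows `x` contains exactly one
ideal which contains `x` but not `y`. -/
theorem height_sum_chainExp_eq {x y : Hat P} (hxy : x ⋖ y)
    (h : ∀ z, key x ≤ key z → key z < key y → z = x) :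
    height (∑ i, chainExp key i) x = height (∑ i, chainExp key i) y + 1 := by
  have hlt : key x < key y := (hkey hxy.le).lt_of_ne (hinj.ne hxy.ne)
  obtain ⟨i, rfl⟩ : ∃ i, x = toHat i := (eq_top_or_eq_toHat x).resolve_left hxy.lt.ne_top
  rw [← sub_eq_iff_eq_add', height_sum_chainExp_sub hkey hinj, Finset.sum_eq_single i]
  · simp [hlt.not_ge]
  · intro j _ hj
    split_ifs with h1 h2 h2
    · simp
    · exact absurd (toHat_injective (h _ h1 (not_le.1 h2))) hj
    · exact absurd (hlt.le.trans h2) h1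
    · simp
  · simp

end Chains

/-! ### Generation by a maximal chain of ideals -/

section Generation

variable {k : Type*} [Field k] {P : Type*} [PartialOrder P] [Fintype P]
  {L : Type*} [LinearOrder L] {key : Hat P → L} (hkey : Monotone key)
  (hinj : Function.Injective key)

theorem mono_sum {ι : Type*} (s : Finset ι) {f : ι → Option P →₀ ℕ}
    (hf : ∀ i, Antitone (height (f i))) (h : Antitone (height (∑ i ∈ s, f i))) :
    mono k (∑ i ∈ s, f i) h = ∏ i ∈ s, mono k (f i) (hf i) := by
  ext1
  simp [mono, MvPolynomial.monomial_sum_one]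

variable (k) in
/-- The monomial of the poset ideal of all elements up to `i` in the linear order given by `key`. -/
def chainMono (i : Option P) : hibiRing k P :=
  mono k (chainExp key i) (antitone_height_chainExp hkey hinj i)

theorem mono_sum_chainExp {ι : Type*} (s : Finset ι) (j : ι → Option P)
    (h : Antitone (height (∑ i ∈ s, chainExp key (j i)))) :
    mono k (∑ i ∈ s, chainExp key (j i)) h = ∏ i ∈ s, chainMono k hkey hinj (j i) :=
  mono_sum s (fun i => antitone_height_chainExp hkey hinj (j i)) h

/-- The monomials of a maximal chain of ideals generate the fraction field of the Hibi ring, so a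
derivation into a torsion-free module which kills them vanishes. -/
theorem derivation_eq_zero {M : Type*} [AddCommGroup M] [Module (hibiRing k P) M] [Module k M]
    [IsScalarTower k (hibiRing k P) M] [Module.IsTorsionFree (hibiRing k P) M]
    (d : Derivation k (hibiRing k P) M) (hd : ∀ i, d (chainMono k hkey hinj i) = 0) : d = 0 := by
  have hprod : ∀ {ι : Type} (s : Finset ι) (j : ι → Option P),
      d (∏ i ∈ s, chainMono k hkey hinj (j i)) = 0 := by
    classical
    intro ι s j
    induction s using Finset.induction_on with
    | empty => simp
    | insert i s hi ih => rw [Finset.prod_insert hi, Derivation.leibniz, ih, hd, smul_zero,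
        smul_zero, add_zero]
  have hsum : ∀ {a : Option P →₀ ℕ} (ha : Antitone (height a)),
      (∀ i j, key (toHat i) ≤ key (toHat j) → a j ≤ a i) → d (mono k a ha) = 0 := by
    intro a ha h
    obtain ⟨s, j, rfl⟩ := exists_eq_sum_chainExp hkey h
    rw [mono_sum_chainExp hkey hinj]
    exact hprod s j
  have hs := antitone_height_sum_chainExp (P := P) hkey hinj
  have hmono : ∀ {a : Option P →₀ ℕ} (ha : Antitone (height a)), d (mono k a ha) = 0 := by
    intro a ha
    -- Adding a large multiple of the strictly decreasing vector `s` makes `a` decrease along `key`.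
    let s : Option P →₀ ℕ := ∑ i, chainExp key i
    have hslt : ∀ i j, key (toHat i) < key (toHat j) → s j + 1 ≤ s i := by
      intro i j hij
      have := height_sum_chainExp_lt hkey hinj hij
      simp only [height_toHat] at this
      exact_mod_cast this
    have hsle : ∀ i j, key (toHat i) ≤ key (toHat j) → s j ≤ s i := by
      intro i j hij
      rcases hij.lt_or_eq with h | h
      · exact (Nat.le_succ _).trans (hslt i j h)
      · rw [toHat_injective (hinj h)]
    have hN : Antitone (height (a none • s)) := by
      have h : ∀ x, height (a none • s) x = ∑ _r ∈ Finset.range (a none), height s x := fun x => by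
        rw [← height_sum]
        simp
      intro x y hxy
      rw [h, h]
      exact Finset.sum_le_sum fun _ _ => hs hxy
    have h1 : d (mono k (a none • s) hN) = 0 :=
      hsum hN fun i j hij => by simpa using Nat.mul_le_mul_left _ (hsle i j hij)
    have h2 : d (mono k (a + a none • s) (antitone_height_add ha hN)) = 0 := by
      refine hsum _ fun i j hij => ?_
      simp only [Finsupp.add_apply, Finsupp.smul_apply, smul_eq_mul]
      rcases hij.lt_or_eq with h | h
      · calc a j + a none * s j ≤ a none + a none * s j :=
              Nat.add_le_add_right (le_apply_none ha j) _
          _ = a none * (s j + 1) := by ring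
          _ ≤ a none * s i := Nat.mul_le_mul_left _ (hslt i j h)
          _ ≤ a i + a none * s i := Nat.le_add_left _ _
      · rw [toHat_injective (hinj h)]
    rw [← mono_mul_mono ha hN, Derivation.leibniz, h1, smul_zero, zero_add] at h2
    exact (smul_eq_zero.1 h2).resolve_left (mono_ne_zero hN)
  ext f
  have hf : f ∈ Submodule.span k {f : hibiRing k P | ∃ a ha, f = mono k a ha} :=
    span_range_mono (k := k) (P := P) ▸ Submodule.mem_top
  induction hf using Submodule.span_induction with
  | mem f hf =>
    obtain ⟨a, ha, rfl⟩ := hf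
    exact hmono ha
  | zero => simp
  | add f g _ _ hf hg => rw [map_add, hf, hg]; simp
  | smul r f _ hf => rw [Derivation.map_smul, hf]; simp

end Generation

/-! ### Linear forms on top differentials -/

section Forms

open KaehlerDifferential

universe u

variable {k : Type*} [Field k] {A : Type*} [CommRing A] [Algebra k A]
  {ι : Type*} (e : Fin (Cardinal.toNat (Algebra.trdeg k A)) ≃ ι)

/-- The top form `⋀ dc_i`, the order of the factors being given by `e`. -/
def wedge (c : ι → A) : TopForms k A :=
  exteriorPower.ιMulti A _ fun j => D k A (c (e j))

/-- The values of the linear forms on top differentials at the form `⋀ dc_i`. When the `c_i`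
generate the fraction field this is a fractional-ideal model of the dual of the module of top
differentials. -/
def formValues (c : ι → A) : Ideal A :=
  LinearMap.range (LinearMap.applyₗ (R := A) (M₂ := A) (wedge e c))

theorem mem_formValues {c : ι → A} {b : A} :
    b ∈ formValues e c ↔ ∃ ψ : Module.Dual A (TopForms k A), ψ (wedge e c) = b :=
  Iff.rfl

/-- The values at the form `⋀ dc_i` of the linear forms of degree `i`. -/
def formValuesDegree (𝒜 : ℤ → AddSubgroup A) (i : ℤ) (c : ι → A) : Set A :=
  {b | ∃ ψ ∈ dualDegree 𝒜 (topFormsDegree k 𝒜) i, ψ (wedge e c) = b}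

/-- Elements `c_i` of which no nonzero derivation into a torsion-free module kills all. In a domain
this says that the `dc_i` span the module of differentials up to torsion. -/
def IsDifferentiallyGenerating (k : Type*) [Field k] {A : Type u} [CommRing A] [Algebra k A]
    {ι : Type*} (c : ι → A) : Prop :=
  ∀ (M : Type u) [AddCommGroup M] [Module A M] [Module k M] [IsScalarTower k A M]
    [Module.IsTorsionFree A M] (d : Derivation k A M), (∀ i, d (c i) = 0) → d = 0

theorem IsDifferentiallyGenerating.exists_smul_mem_span [IsDomain A] {c : ι → A}
    (hc : IsDifferentiallyGenerating k c) (ω : Ω[A⁄k]) :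
    ∃ r : A, r ≠ 0 ∧ r • ω ∈ Submodule.span A (Set.range fun i => D k A (c i)) := by
  set W := Submodule.span A (Set.range fun i => D k A (c i)) with hW
  let T := Submodule.torsion A (Ω[A⁄k] ⧸ W)
  let q : Ω[A⁄k] →ₗ[A] (Ω[A⁄k] ⧸ W) ⧸ T := T.mkQ ∘ₗ W.mkQ
  have hz : q.compDer (D k A) = 0 := by
    refine hc _ _ fun i => ?_
    have : W.mkQ (D k A (c i)) = 0 :=
      (Submodule.Quotient.mk_eq_zero W).2 (Submodule.subset_span ⟨i, rfl⟩)
    change T.mkQ (W.mkQ (D k A (c i))) = 0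
    rw [this, map_zero]
  have hq : q = 0 := by
    refine Derivation.liftKaehlerDifferential_unique _ _ ?_
    rw [hz]
    ext x
    simp
  have hω : W.mkQ ω ∈ T := (Submodule.Quotient.mk_eq_zero T).1 (LinearMap.congr_fun hq ω)
  obtain ⟨r, hr⟩ := (Submodule.mem_torsion_iff _).1 hω
  exact ⟨r, nonZeroDivisors.coe_ne_zero r, (Submodule.Quotient.mk_eq_zero W).1 hr⟩

/-- Any two linear forms on top differentials are proportional: up to a nonzero factor, each
`ω₁ ∧ ⋯ ∧ ω_d` is a multiple of `⋀ dc_i`. -/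
theorem IsDifferentiallyGenerating.apply_mul_apply [IsDomain A] {c : ι → A}
    (hc : IsDifferentiallyGenerating k c) (φ ψ : Module.Dual A (TopForms k A))
    (n : TopForms k A) : ψ (wedge e c) * φ n = φ (wedge e c) * ψ n := by
  set u : Fin (Cardinal.toNat (Algebra.trdeg k A)) → Ω[A⁄k] := fun j => D k A (c (e j)) with hu
  suffices h : ψ (wedge e c) • φ = φ (wedge e c) • ψ from LinearMap.congr_fun h n
  refine exteriorPower.linearMap_ext ?_
  ext1 ω
  have hspan : Set.range (fun i => D k A (c i)) = Set.range u := by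
    rw [hu, ← e.surjective.range_comp]
    rfl
  have hex : ∀ j, ∃ r : A, r ≠ 0 ∧ ∃ b : Fin (Cardinal.toNat (Algebra.trdeg k A)) → A,
      r • ω j = Fintype.linearCombination A u b := by
    intro j
    obtain ⟨r, hr, h⟩ := hc.exists_smul_mem_span (ω j)
    rw [hspan, ← Fintype.range_linearCombination] at h
    obtain ⟨b, hb⟩ := h
    exact ⟨r, hr, b, hb.symm⟩
  choose r hr b hb using hex
  have key : ∀ f : Module.Dual A (TopForms k A), (∏ j, r j) * f (exteriorPower.ιMulti A _ ω) =
      f (wedge e c) * (Pi.basisFun A _).det b := by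
    intro f
    let F := f.compAlternatingMap (exteriorPower.ιMulti A _)
    have h2 := congrArg (fun g => g b)
      ((F.compLinearMap (Fintype.linearCombination A u)).eq_smul_basis_det (Pi.basisFun A _))
    simp only [AlternatingMap.compLinearMap_apply, AlternatingMap.smul_apply] at h2
    have h3 : (∏ j, r j) • F ω = F fun j => r j • ω j := (F.map_smul_univ r ω).symm
    have h4 : (fun j => Fintype.linearCombination A u (Pi.basisFun A _ j)) = u := by
      ext j
      simp
    rw [h4] at h2
    simp only [← hb] at h2
    rw [← smul_eq_mul, ← smul_eq_mul]
    exact h3.trans h2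
  refine mul_left_cancel₀ (Finset.prod_ne_zero_iff.2 fun j _ => hr j : (∏ j, r j) ≠ 0) ?_
  have h1 := key φ
  have h2 := key ψ
  simp only [LinearMap.compAlternatingMap_apply, LinearMap.smul_apply, smul_eq_mul]
  linear_combination ψ (wedge e c) * h1 - φ (wedge e c) * h2

section Det

variable [Fintype ι] [DecidableEq ι] (d : ι → Derivation k A A)

/-- The linear form `ω₁ ∧ ⋯ ∧ ω_d ↦ det (d_i(ω_j))` given by a family of derivations. -/
def detForm : Module.Dual A (TopForms k A) :=
  exteriorPower.alternatingMapLinearEquiv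
    (((Matrix.detRowAlternating (R := A) (n := ι)).compLinearMap
      (LinearMap.pi fun i => (d i).liftKaehlerDifferential)).domDomCongr e.symm)

theorem detForm_ιMulti (ω : Fin (Cardinal.toNat (Algebra.trdeg k A)) → Ω[A⁄k]) :
    detForm e d (exteriorPower.ιMulti A _ ω) =
      (Matrix.of fun j i => (d i).liftKaehlerDifferential (ω (e.symm j))).det := by
  rw [detForm, exteriorPower.alternatingMapLinearEquiv_apply_ιMulti]
  rfl

theorem detForm_wedge (c : ι → A) :
    detForm e d (wedge e c) = (Matrix.of fun j i => d i (c j)).det := by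
  rw [wedge, detForm_ιMulti]
  simp

/-- If the differences of two of the derivations, or one of the derivations, take values in an
ideal, then so does their determinant, as the matrix is singular modulo the ideal. -/
theorem detForm_mem {I : Ideal A}
    (hI : (∃ i, ∀ b, d i b ∈ I) ∨ ∃ i j, i ≠ j ∧ ∀ b, d i b - d j b ∈ I) (n : TopForms k A) :
    detForm e d n ∈ I := by
  have hlift : ∀ δ : Derivation k A A, (∀ b, δ b ∈ I) → ∀ ω : Ω[A⁄k],
      δ.liftKaehlerDifferential ω ∈ I := by
    intro δ hδ ω
    have hω : ω ∈ Submodule.span A (Set.range (D k A)) := by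
      rw [span_range_derivation]
      trivial
    induction hω using Submodule.span_induction with
    | mem ω hω =>
      obtain ⟨b, rfl⟩ := hω
      simpa using hδ b
    | zero => simp
    | add ω ω' _ _ h h' => simpa using I.add_mem h h'
    | smul a ω _ h => simpa using I.mul_mem_left a h
  have hn : n ∈ Submodule.span A (Set.range (exteriorPower.ιMulti A
      (Cardinal.toNat (Algebra.trdeg k A)) (M := Ω[A⁄k]))) := by
    rw [exteriorPower.ιMulti_span]
    trivial
  induction hn using Submodule.span_induction with
  | mem n hn =>
    obtain ⟨ω, rfl⟩ := hn
    rw [detForm_ιMulti, ← Ideal.Quotient.eq_zero_iff_mem, RingHom.map_det]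
    rcases hI with ⟨i, hi⟩ | ⟨i, j, hij, h⟩
    · refine Matrix.det_eq_zero_of_column_eq_zero i fun j => ?_
      exact Ideal.Quotient.eq_zero_iff_mem.2 (hlift (d i) hi _)
    · refine Matrix.det_zero_of_column_eq hij fun l => ?_
      refine (Ideal.Quotient.mk_eq_mk_iff_sub_mem _ _).2 ?_
      have hl : (d i).liftKaehlerDifferential - (d j).liftKaehlerDifferential =
          (d i - d j).liftKaehlerDifferential := by
        refine Derivation.liftKaehlerDifferential_unique _ _ ?_
        ext b
        simp
      have := hlift (d i - d j) h (ω (e.symm l))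
      rw [← hl] at this
      exact this
  | zero => simp
  | add n n' _ _ h h' => simpa using I.add_mem h h'
  | smul a n _ h => simpa using I.mul_mem_left a h

theorem IsDifferentiallyGenerating.exists_det_mul_eq [IsDomain A] {c : ι → A}
    (hc : IsDifferentiallyGenerating k c) (c' : ι → A) {b : A} (hb : b ∈ formValues e c) :
    ∃ b' : A, (Matrix.of fun j i => d i (c j)).det * b' =
      (Matrix.of fun j i => d i (c' j)).det * b := by
  obtain ⟨ψ, rfl⟩ := (mem_formValues e).1 hb
  refine ⟨ψ (wedge e c'), ?_⟩
  rw [← detForm_wedge e, ← detForm_wedge e, hc.apply_mul_apply e ψ (detForm e d), mul_comm]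

/-- A multiple of the determinant form may be divided by a common divisor of its values. -/
theorem exists_mem_formValues_of_dvd [IsDomain A] {F : Set (Ideal A)}
    (hF : ∀ I ∈ F, (∃ i, ∀ b, d i b ∈ I) ∨ ∃ i j, i ≠ j ∧ ∀ b, d i b - d j b ∈ I)
    {z w : A} (hz : z ≠ 0) (hdvd : ∀ y, (∀ I ∈ F, y ∈ I) → z ∣ w * y) (c : ι → A) :
    ∃ b ∈ formValues e c, z * b = w * (Matrix.of fun j i => d i (c j)).det := by
  have h : ∀ n, ∃ b, w * detForm e d n = z * b := fun n =>
    hdvd _ fun I hI => detForm_mem e d (hF I hI) n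
  choose f hf using h
  let ψ : Module.Dual A (TopForms k A) :=
    { toFun := f
      map_add' := fun n n' => mul_left_cancel₀ hz (by
        rw [mul_add, ← hf, ← hf, ← hf, map_add, mul_add])
      map_smul' := fun a n => mul_left_cancel₀ hz (by
        rw [RingHom.id_apply, smul_eq_mul, mul_left_comm, ← hf, ← hf, map_smul, smul_eq_mul,
          mul_left_comm]) }
  exact ⟨f (wedge e c), ⟨ψ, rfl⟩, by rw [← hf, detForm_wedge]⟩

end Det

theorem mem_of_mem_formValuesDegree {𝒜 : ℤ → AddSubgroup A} (h1 : (1 : A) ∈ 𝒜 0) {c : ι → A}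
    (hc : ∀ i, c i ∈ 𝒜 1) {i : ℤ} {b : A} (hb : b ∈ formValuesDegree e 𝒜 i c) :
    b ∈ 𝒜 (Cardinal.toNat (Algebra.trdeg k A) + i) := by
  obtain ⟨ψ, hψ, rfl⟩ := hb
  refine hψ _ _ (AddSubgroup.subset_closure
    ⟨1, fun j => c (e j), 0, fun _ => 1, h1, fun j => hc _, by simp, ?_⟩)
  rw [one_smul, wedge]

/-- The dual of evaluation `M → M^{**}` is surjective, so a module with anticanonical module
generated in one degree has its values `formValues` generated in that degree. -/
theorem IsAnticanonicalLevel.exists_formValues_le {𝒜 : ℤ → AddSubgroup A}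
    (h : IsAnticanonicalLevel k 𝒜) :
    ∃ m : ℤ, ∀ c : ι → A, formValues e c ≤ Ideal.span (formValuesDegree e 𝒜 m c) := by
  obtain ⟨m, hm⟩ := h
  refine ⟨m, fun c b hb => ?_⟩
  obtain ⟨ψ, rfl⟩ := (mem_formValues e).1 hb
  have key : ∀ Φ : AnticanonicalModule k A,
      Φ (Module.Dual.eval A _ (wedge e c)) ∈ Ideal.span (formValuesDegree e 𝒜 m c) := by
    intro Φ
    have hΦ : Φ ∈ Submodule.span A (anticanonicalDegree k 𝒜 m : Set (AnticanonicalModule k A)) :=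
      hm ▸ Submodule.mem_top
    induction hΦ using Submodule.span_induction with
    | mem Φ hΦ =>
      refine Ideal.subset_span ⟨Φ ∘ₗ Module.Dual.eval A _, fun j x hx => ?_, rfl⟩
      refine hΦ j _ fun i φ hφ => ?_
      rw [add_comm]
      exact hφ j x hx
    | zero => simp
    | add Φ Φ' _ _ h h' => exact Ideal.add_mem _ h h'
    | smul a Φ _ h => exact Ideal.mul_mem_left _ a h
  exact key (Module.Dual.eval A _ ψ)

/-- If the ideal of values is principal, the dual of the module of top differentials is free of
rank one, and so is the canonical module. -/
theorem IsDifferentiallyGenerating.isGorenstein [IsDomain A] {c : ι → A}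
    (hc : IsDifferentiallyGenerating k c) {b : A} (hb0 : b ≠ 0) (hb : b ∈ formValues e c)
    (h : ∀ b' ∈ formValues e c, b ∣ b') : IsGorenstein k A := by
  obtain ⟨ψ, rfl⟩ := (mem_formValues e).1 hb
  have hψ : ∀ φ : Module.Dual A (TopForms k A), ∃ a : A, a • ψ = φ := by
    intro φ
    obtain ⟨a, ha⟩ := h _ ((mem_formValues e).2 ⟨φ, rfl⟩)
    refine ⟨a, LinearMap.ext fun n => mul_left_cancel₀ hb0 ?_⟩
    rw [hc.apply_mul_apply e φ ψ, ha, LinearMap.smul_apply, smul_eq_mul]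
    ring
  let f : A ≃ₗ[A] Module.Dual A (TopForms k A) :=
    LinearEquiv.ofBijective (LinearMap.toSpanSingleton A _ ψ) ⟨by
      intro a a' haa
      have := LinearMap.congr_fun haa (wedge e c)
      simpa [hb0] using this, hψ⟩
  have : Module.Invertible A (Module.Dual A (TopForms k A)) := Module.Invertible.congr f
  exact inferInstanceAs (Module.Invertible A (Module.Dual A (Module.Dual A (TopForms k A))))

end Forms

/-! ### The anticanonical module of the Hibi ring -/

section Anticanonical

open MvPolynomial

variable {k : Type*} [Field k] {P : Type*} [PartialOrder P] [Fintype P]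

/-- Each variable is a quotient of two monomials of poset ideals. -/
theorem isAlgebraic_hibiRing : Algebra.IsAlgebraic (hibiRing k P) (MvPolynomial (Option P) k) := by
  classical
  have hmem : ∀ I : LowerSet P, idealMonomial k I ∈ hibiRing k P := fun I =>
    Algebra.subset_adjoin ⟨I, rfl⟩
  have hX : ∀ i : Option P, IsAlgebraic (hibiRing k P) (X i : MvPolynomial (Option P) k) := by
    rintro (_ | v)
    · have h := isAlgebraic_algebraMap (R := hibiRing k P) (A := MvPolynomial (Option P) k)
        (⟨_, hmem ⊥⟩ : hibiRing k P)
      have h0 : algebraMap (hibiRing k P) (MvPolynomial (Option P) k)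
          (⟨_, hmem ⊥⟩ : hibiRing k P) = X none := by
        change idealMonomial k ⊥ = X none
        simp [idealMonomial]
      rwa [h0] at h
    · let p : hibiRing k P := ⟨_, hmem (LowerSet.Iio v)⟩
      let q : hibiRing k P := ⟨_, hmem (LowerSet.Iic v)⟩
      have hpq : (p : MvPolynomial (Option P) k) * (X (some v) : MvPolynomial (Option P) k) =
          (q : MvPolynomial (Option P) k) := by
        have h : (Finset.univ.filter fun w : P => w ∈ LowerSet.Iic v) =
            insert v (Finset.univ.filter fun w : P => w ∈ LowerSet.Iio v) := by
          ext w
          simp [le_iff_eq_or_lt]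
        change idealMonomial k (LowerSet.Iio v) * X (some v) = idealMonomial k (LowerSet.Iic v)
        rw [idealMonomial, idealMonomial, h, Finset.prod_insert (by simp)]
        ring
      have hp : p ≠ 0 := by
        intro h0
        have h1 : idealMonomial k (LowerSet.Iio v) = 0 := congrArg Subtype.val h0
        rw [idealMonomial, mul_eq_zero, Finset.prod_eq_zero_iff] at h1
        rcases h1 with h1 | ⟨w, -, h1⟩
        · exact X_ne_zero _ h1
        · exact X_ne_zero _ h1
      refine ⟨Polynomial.C p * Polynomial.X - Polynomial.C q, fun h0 => hp ?_, ?_⟩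
      · simpa using congrArg (fun f => Polynomial.coeff f 1) h0
      · rw [map_sub, map_mul, Polynomial.aeval_C, Polynomial.aeval_X, Polynomial.aeval_C]
        exact sub_eq_zero.2 hpq
  refine ⟨fun f => ?_⟩
  induction f using MvPolynomial.induction_on with
  | C r => exact isAlgebraic_algebraMap (algebraMap k (hibiRing k P) r)
  | add f g hf hg => exact hf.add hg
  | mul_X f i hf => exact hf.mul (hX i)

variable (k P) in
theorem toNat_trdeg_hibiRing :
    Cardinal.toNat (Algebra.trdeg k (hibiRing k P)) = Fintype.card (Option P) := by
  have := isAlgebraic_hibiRing (k := k) (P := P)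
  have h := trdeg_add_eq k (hibiRing k P) (A := MvPolynomial (Option P) k)
  rw [trdeg_eq_zero (R := hibiRing k P) (A := MvPolynomial (Option P) k), add_zero,
    MvPolynomial.trdeg_of_isDomain] at h
  have := congrArg Cardinal.toNat h
  simpa using this

section Chain

variable {L : Type*} [LinearOrder L] {key : Hat P → L} (hkey : Monotone key)
  (hinj : Function.Injective key)

theorem isDifferentiallyGenerating_chainMono :
    IsDifferentiallyGenerating k (chainMono k hkey hinj) :=
  fun _ _ _ _ _ _ d hd => derivation_eq_zero hkey hinj d hd

/-- The matrix of Euler derivatives of a maximal chain of ideals is triangular. -/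
theorem det_euler_chainMono [DecidableEq (Option P)] :
    (Matrix.of fun j i => euler k i (chainMono k hkey hinj j)).det =
      mono k (∑ i, chainExp key i) (antitone_height_sum_chainExp hkey hinj) := by
  let ord : LinearOrder (Option P) :=
    LinearOrder.lift' (fun i => key (toHat i)) (hinj.comp toHat_injective)
  have happ : ∀ i j, euler k i (chainMono k hkey hinj j) =
      (chainExp key j i : hibiRing k P) * chainMono k hkey hinj j := fun i j => euler_mono i _
  rw [mono_sum_chainExp hkey hinj]
  convert Matrix.det_of_isLowerTriangular
    (Matrix.of fun j i => euler k i (chainMono k hkey hinj j)) ?_ using 1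
  · refine Finset.prod_congr rfl fun j _ => ?_
    simp [happ, chainExp_apply]
  · intro j i hij
    have : key (toHat j) < key (toHat i) := hij
    simp [happ, chainExp_apply, this.not_ge]

end Chain

variable (k P) in
/-- The set of facet ideals of the Hibi ring, one for each cover in `P̂`. -/
def facetIdeals : Set (Ideal (hibiRing k P)) :=
  {I | ∃ (x y : Hat P) (h : x ⋖ y), I = facetIdeal k x y h.le}

theorem euler_mem_facetIdeal {I : Ideal (hibiRing k P)} (hI : I ∈ facetIdeals k P) :
    (∃ i, ∀ b, euler k i b ∈ I) ∨ ∃ i j, i ≠ j ∧ ∀ b, euler k i b - euler k j b ∈ I := by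
  obtain ⟨x, y, h, rfl⟩ := hI
  obtain ⟨i, rfl⟩ : ∃ i, x = toHat i := (eq_top_or_eq_toHat x).resolve_left h.lt.ne_top
  rcases eq_top_or_eq_toHat y with rfl | ⟨j, rfl⟩
  · refine Or.inl ⟨i, fun b a ha => ?_⟩
    rw [mem_support_iff, coeff_euler] at ha
    have : a i ≠ 0 := fun h0 => ha (by simp [h0])
    simpa using Nat.pos_of_ne_zero this
  · refine Or.inr ⟨i, j, fun hij => h.ne (by rw [hij]), fun b a ha => ?_⟩
    rw [mem_support_iff, AddSubgroupClass.coe_sub, coeff_sub, coeff_euler, coeff_euler,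
      ← sub_mul] at ha
    have hne : a i ≠ a j := fun h0 => ha (by simp [h0])
    have hle := (mem_hibiRing_iff k).1 b.2 a (mem_support_iff.2 (right_ne_zero_of_mul ha)) h.le
    refine lt_of_le_of_ne hle ?_
    simpa using hne.symm

section Values

variable {L : Type*} [LinearOrder L] {key : Hat P → L} (hkey : Monotone key)
  (hinj : Function.Injective key)
  (e : Fin (Cardinal.toNat (Algebra.trdeg k (hibiRing k P))) ≃ Option P)

/-- Values of linear forms on top differentials have weights as exponents, relative to the exponent
of the chain monomial. For the inequality of the cover `x ⋖ y`, compare with a chain in which only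
one ideal contains `x` but not `y`. -/
theorem isWeight_of_mem_formValues {g : hibiRing k P}
    (hg : g ∈ formValues e (chainMono k hkey hinj)) {a : Option P →₀ ℕ}
    (ha : a ∈ (g : MvPolynomial (Option P) k).support) :
    IsWeight (height a - height (∑ i, chainExp key i)) := by
  classical
  refine ⟨by simp, fun x y hxy => ?_⟩
  obtain ⟨key', hkey', hinj', hadj⟩ := exists_key_of_covBy hxy
  obtain ⟨g', hg'⟩ := (isDifferentiallyGenerating_chainMono hkey hinj).exists_det_mul_eq e
    (euler k) (chainMono k hkey' hinj') hg
  rw [det_euler_chainMono, det_euler_chainMono] at hg'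
  have h1 := mem_support_mono_mul (antitone_height_sum_chainExp hkey' hinj') ha
  rw [← hg'] at h1
  obtain ⟨c, hc, hac⟩ := exists_of_mem_support_mono_mul _ h1
  have h2 := (mem_hibiRing_iff k).1 g'.2 c hc hxy.le
  have h3 := congrFun (congrArg height hac) x
  have h4 := congrFun (congrArg height hac) y
  have h5 := height_sum_chainExp_eq hkey' hinj' hxy hadj
  simp only [height_add, Pi.add_apply, Pi.sub_apply] at h3 h4 ⊢
  linarith

include hkey hinj in
theorem antitone_sum_chainExp_add {ν : Hat P → ℤ} (hν : IsWeight ν) :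
    Antitone (height (∑ i, chainExp key i) + ν) :=
  antitone_of_covBy fun x y hxy => by
    have h1 := height_sum_chainExp_lt hkey hinj ((hkey hxy.le).lt_of_ne (hinj.ne hxy.ne))
    have h2 := hν.2 x y hxy
    simp only [Pi.add_apply]
    omega

/-- Each weight is realized by a linear form on top differentials. -/
theorem exists_mono_mem_formValues {ν : Hat P → ℤ} (hν : IsWeight ν) :
    ∃ (b : Option P →₀ ℕ) (hb : Antitone (height b)),
      height b = height (∑ i, chainExp key i) + ν ∧
        mono k b hb ∈ formValues e (chainMono k hkey hinj) := by
  classical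
  have hs := antitone_height_sum_chainExp hkey hinj
  have hanti := antitone_sum_chainExp_add hkey hinj hν
  obtain ⟨b, hb⟩ := exists_height_eq hanti (by simp [hν.1])
  have hb' : Antitone (height b) := hb ▸ hanti
  obtain ⟨g, hg, hgb⟩ := exists_mem_formValues_of_dvd e (euler k) (F := facetIdeals k P)
    (fun I hI => euler_mem_facetIdeal hI) (z := mono k _ hs) (w := mono k b hb')
    (mono_ne_zero hs) (fun y hy => by
      obtain ⟨g, hg⟩ := exists_mono_mul_eq hs (f := mono k b hb' * y) fun a ha => by
        obtain ⟨c, hc, rfl⟩ := exists_of_mem_support_mono_mul _ ha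
        refine antitone_of_covBy fun x z hxz => ?_
        have h1 := hy _ ⟨x, z, hxz, rfl⟩ c hc
        have h2 := hν.2 x z hxz
        simp only [height_add, hb, Pi.add_apply, Pi.sub_apply]
        linarith
      exact ⟨g, hg.symm⟩) (chainMono k hkey hinj)
  refine ⟨b, hb', hb, ?_⟩
  rw [det_euler_chainMono, mul_comm] at hgb
  rwa [← mul_right_cancel₀ (mono_ne_zero hs) hgb]

/-- The combinatorial form of levelness: every weight is the sum of an antitone function and a
weight of a fixed degree. -/
theorem exists_weight_of_isAnticanonicalLevel
    (hlevel : IsAnticanonicalLevel k (hibiDegree k P)) :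
    ∃ m : ℤ, ∀ ν : Hat P → ℤ, IsWeight ν →
      ∃ ν₀, IsWeight ν₀ ∧ ν₀ ⊥ = m ∧ Antitone (ν - ν₀) := by
  classical
  let e : Fin (Cardinal.toNat (Algebra.trdeg k (hibiRing k P))) ≃ Option P :=
    Fintype.equivOfCardEq (by rw [Fintype.card_fin, toNat_trdeg_hibiRing])
  have hkey : Monotone (toLinearExtension : Hat P → LinearExtension (Hat P)) :=
    toLinearExtension.monotone
  have hinj : Function.Injective (toLinearExtension : Hat P → LinearExtension (Hat P)) :=
    fun _ _ h => h
  obtain ⟨m, hm⟩ := hlevel.exists_formValues_le e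
  have hdeg : ∀ (g : hibiRing k P) (i : ℤ) , g ∈ hibiDegree k P i →
      ∀ a ∈ (g : MvPolynomial (Option P) k).support, (a none : ℤ) = i := by
    intro g i hg a ha
    have h1 : Finsupp.weight (tWeight P) a = i := hg (mem_support_iff.1 ha)
    rw [← h1, Finsupp.weight_apply, Finsupp.sum_fintype _ _ (by simp), Fintype.sum_option]
    simp [tWeight]
  have hdeg' : ∀ {a : Option P →₀ ℕ} (ha : Antitone (height a)) {i : ℤ}, (a none : ℤ) = i →
      mono k a ha ∈ hibiDegree k P i := by
    intro a ha i hi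
    refine isWeightedHomogeneous_monomial _ _ _ ?_
    rw [Finsupp.weight_apply, Finsupp.sum_fintype _ _ (by simp), Fintype.sum_option]
    simpa [tWeight] using hi
  have hone : (1 : hibiRing k P) ∈ hibiDegree k P 0 := isWeightedHomogeneous_one _ _
  have hchain : ∀ i : Option P,
      chainExp (toLinearExtension : Hat P → LinearExtension (Hat P)) i none = 1 := by
    intro i
    rw [chainExp_apply, if_pos (hkey (show toHat none ≤ toHat i from bot_le))]
  have hc : ∀ i, chainMono k hkey hinj i ∈ hibiDegree k P 1 := fun i =>
    hdeg' _ (by rw [hchain i]; rfl)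
  refine ⟨m, fun ν hν => ?_⟩
  obtain ⟨b, hb, hbν, hmem⟩ := exists_mono_mem_formValues (k := k) hkey hinj e hν
  set s := ∑ i, chainExp (toLinearExtension : Hat P → LinearExtension (Hat P)) i with hs
  have key : ∀ g ∈ Ideal.span (formValuesDegree e (hibiDegree k P) m (chainMono k hkey hinj)),
      ∀ a ∈ (g : MvPolynomial (Option P) k).support,
        ∃ ν₀, IsWeight ν₀ ∧ ν₀ ⊥ = m ∧ Antitone (height a - height s - ν₀) := by
    intro g hg
    induction hg using Submodule.span_induction with
    | mem g hg =>
      intro a ha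
      refine ⟨height a - height s, isWeight_of_mem_formValues hkey hinj e ?_ ha, ?_, ?_⟩
      · obtain ⟨ψ, -, hψ⟩ := hg
        exact ⟨ψ, hψ⟩
      · have h1 := hdeg _ _ (mem_of_mem_formValuesDegree e hone hc hg) a ha
        have h2 : height s ⊥ = Cardinal.toNat (Algebra.trdeg k (hibiRing k P)) := by
          rw [hs, height_sum, toNat_trdeg_hibiRing]
          simp only [height_bot, hchain _]
          simp
        rw [Pi.sub_apply, height_bot, h1, h2]
        ring
      · rw [sub_self]
        exact antitone_const
    | zero => simp
    | add g g' _ _ h h' =>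
      intro a ha
      rcases Finset.mem_union.1 (support_add ha) with h1 | h1
      exacts [h a h1, h' a h1]
    | smul r g _ h =>
      intro a ha
      obtain ⟨c, hc, a', ha', rfl⟩ := Finset.mem_add.1 (support_mul _ _ ha)
      obtain ⟨ν₀, h1, h2, h3⟩ := h a' ha'
      refine ⟨ν₀, h1, h2, ?_⟩
      have h4 := ((mem_hibiRing_iff k).1 r.2 c hc).add h3
      have h5 : height (c + a') - height s - ν₀ = height c + (height a' - height s - ν₀) := by
        rw [height_add]
        abel
      rw [h5]
      exact h4
  obtain ⟨ν₀, h1, h2, h3⟩ := key _ (hm _ hmem) b (by simp [mono])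
  refine ⟨ν₀, h1, h2, ?_⟩
  rwa [hbν, add_sub_cancel_left] at h3

/-- If all maximal chains of `P̂` have the same length, the weight `-dist(·, ∞)` is tight at every
cover and its monomial generates the anticanonical module. -/
theorem isGorenstein_of_dist_eq
    (h : ∀ x y : Hat P, x ⋖ y → dist x ⊤ = dist y ⊤ + 1) : IsGorenstein k (hibiRing k P) := by
  let e : Fin (Cardinal.toNat (Algebra.trdeg k (hibiRing k P))) ≃ Option P :=
    Fintype.equivOfCardEq (by rw [Fintype.card_fin, toNat_trdeg_hibiRing])
  have hkey : Monotone (toLinearExtension : Hat P → LinearExtension (Hat P)) :=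
    toLinearExtension.monotone
  have hinj : Function.Injective (toLinearExtension : Hat P → LinearExtension (Hat P)) :=
    fun _ _ h => h
  obtain ⟨b, hb, hbν, hmem⟩ :=
    exists_mono_mem_formValues (k := k) hkey hinj e (isWeight_neg_dist (α := Hat P))
  refine (isDifferentiallyGenerating_chainMono hkey hinj).isGorenstein e (mono_ne_zero hb) hmem
    fun g hg => ?_
  obtain ⟨g', hg'⟩ := exists_mono_mul_eq hb (f := g) fun a ha => antitone_of_covBy fun x y hxy => by
    have h1 := (isWeight_of_mem_formValues hkey hinj e hg ha).2 x y hxy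
    have h2 := h x y hxy
    simp only [hbν, Pi.add_apply, Pi.sub_apply] at h1 ⊢
    omega
  exact ⟨g', hg'.symm⟩

end Values

end Anticanonical

end Hibi

end

theorem proposition4 {k : Type*} [Field k] {P : Type*} [PartialOrder P] [Fintype P]
    (hlevel : Hibi.IsAnticanonicalLevel k (Hibi.hibiDegree k P))
    (hGor : ¬ Hibi.IsGorenstein k (Hibi.hibiRing k P)) :
    ∃ (n : ℕ) (v : Fin (n + 1) → Hibi.Hat P),
      Hibi.IsUpwardsPath v ∧
      Hibi.IsMaximalLengthUpwardsPathIn (Hibi.nonminSubset (Hibi.Hat P)) (Fin.tail v) ∧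
      ∑ i : Fin n, Hibi.disp (v i.castSucc) (v i.succ) < (n : ℤ) := by
  obtain ⟨m, hm⟩ := Hibi.exists_weight_of_isAnticanonicalLevel hlevel
  have hdist : ∀ u w : Hibi.Hat P, u ∈ Hibi.minSubset _ → w ∈ Hibi.minSubset _ → u ≤ w →
      Hibi.dist u w + Hibi.dist w ⊤ ≤ Hibi.dist u ⊤ :=
    fun u w hu hw huw => Hibi.dist_add_dist_le hm hu hw huw
  by_cases hne : (Hibi.nonminSubset (Hibi.Hat P)).Nonempty
  · exact Hibi.exists_path_sum_disp_lt hdist hne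
  · exact absurd (Hibi.isGorenstein_of_dist_eq fun x y hxy =>
      Hibi.dist_eq_add_one_of_covBy hdist hne hxy) hGor
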